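/- Let $\mathbb F_q$ be the finite field with $q$ elements and let $C\subseteq\mathbb F_q^n$ be a linear code of dimension $k$, with minimum (Hamming) distance $d$ (undefined if $C=\{0\}$) and covering radius $\rho=\max_{x}d(x,C)=1$. Suppose that $C$ is completely regular, i.e. the number of codewords at distance $i$ from a vector $x$ depends only on $i$ and on $d(x,C)$. Terminology. Two linear codes are equivalent if one is the image of the other under a monomial map (a permutation of the coordinates together with multiplication of each coordinate by a nonzero scalar); $\mathrm{Aut}(C)$ is the group of monomial maps that leave $C$ invariant; $C$ is completely transitive if $\mathrm{Aut}(C)$ has exactly $\rho+1$ orbits on the cosets of $C$. The $q$-repeated code of $C'\subseteq\mathbb F_q^{m}$ is $\{(a,x): a\in\mathbb F_q,\ x\in C'\}\subseteq\mathbb F_q^{m+1}$. The repetition code of length $r$ is $\{(c,\dots,c):c\in\mathbb F_q\}\subseteq\mathbb F_q^r$. A parity check matrix of a linear code is a matrix with linearly independent rows whose null space is the code. A Hamming code of redundancy $m\ge2$ is the null space of a matrix with $m$ rows whose columns represent every one-dimensional subspace of $\mathbb F_q^m$ exactly once; it has length $(q^m-1)/(q-1)$, dimension $(q^m-1)/(q-1)-m$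 and minimum distance $3$. Then either $n=1$ and $C=\{0\}$, or $d\in\{1,2,3\}$. All vectors $x\notin C$ have the same number $n_a$ of codewords at distance $1$, and the following hold. (i) If $d=1$, then, up to a permutation of the coordinates, $C$ is the $q$-repeated code of a completely regular linear code $C'$ with covering radius $1$; here $C'$ has minimum distance $d'\in\{1,2,3\}$, or $C'=\{0\}\subseteq\mathbb F_q^1$. (ii) If $d=2$, then $n_a>1$ and one of the following holds: - $n=n_a$, $k=n-1$, and for every generator matrix $A$ of the repetition code of length $n_a$, $C$ is equivalent to the code with parity check matrix $A$; - there are $m_b\ge2$ and $n_b=(q^{m_b}-1)/(q-1)$ with $n=n_an_b$ and $k=n-m_b$ such that Hamming codes of length $n_b$ and redundancy $m_b$ exist and, for every generator matrix $A$ of the repetition code of length $n_a$ and every parity check matrix $B$ of such a Hamming code, $C$ is equivalent to the code with parity check matrix $A\otimes B$ (Kronecker product). (iii) If $d=3$, then $n_a=1$ and $C$ is a Hamming code: for some $m_b\ge 2$ we have $n=(q^{m_b}-1)/(q-1)$, $k=n-m_b$, and $C$ is a Hamming code of redundancy $m_b$ with a parity check matrix $B$ with $m_b$ rows. (iv) In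 every case $C$ is completely transitive. -/

import Mathlib

namespace LinearCode

variable {F : Type*} [Field F] {ι κ : Type*}

/-- Distance from the vector `x` to the code `C`. -/
noncomputable def distTo [Fintype ι] [DecidableEq F] (C : Submodule F (ι → F)) (x : ι → F) : ℕ :=
  ⨅ c : C, hammingDist x (c : ι → F)

/-- Covering radius: the maximum over all vectors of the distance to the code
(over a finite field this is a supremum of finitely many values). -/
noncomputable def coveringRadius [Fintype ι] [DecidableEq F] (C : Submodule F (ι → F)) : ℕ :=
  ⨆ x : ι → F, distTo C x

/-- Minimum distance between distinct codewords. It takes the junk value `0` exactly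
when the code is the zero code; otherwise it is positive. -/
noncomputable def minDist [Fintype ι] [DecidableEq F] (C : Submodule F (ι → F)) : ℕ :=
  sInf {t | ∃ x ∈ C, ∃ y ∈ C, x ≠ y ∧ hammingDist x y = t}

/-- Number of codewords at distance exactly `i` from `x`. -/
noncomputable def numAtDist [Fintype ι] [DecidableEq F] (C : Submodule F (ι → F))
    (x : ι → F) (i : ℕ) : ℕ :=
  {c : ι → F | c ∈ C ∧ hammingDist x c = i}.ncard

/-- Completely regular: the number of codewords at distance `i` from a vector `x` depends
only on `i` and on the distance from `x` to the code. -/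
def IsCompletelyRegular [Fintype ι] [DecidableEq F] (C : Submodule F (ι → F)) : Prop :=
  ∀ x y : ι → F, distTo C x = distTo C y → ∀ i, numAtDist C x i = numAtDist C y i

/-- Monomial maps: a bijection of the coordinates together with a multiplication by a nonzero
scalar at each position. -/
def IsMonomial (σ : (ι → F) ≃ₗ[F] (κ → F)) : Prop :=
  ∃ (e : κ ≃ ι) (u : κ → Fˣ), ∀ x j, σ x j = (u j : F) * x (e j)

/-- Equivalence of linear codes (of the same length, with possibly different index sets). -/
def IsEquivalent (C : Submodule F (ι → F)) (D : Submodule F (κ → F)) : Prop :=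
  ∃ σ : (ι → F) ≃ₗ[F] (κ → F), IsMonomial σ ∧ C.map (σ : (ι → F) →ₗ[F] (κ → F)) = D

/-- The full automorphism group: monomial maps leaving the code invariant. -/
def autGroup (C : Submodule F (ι → F)) : Subgroup ((ι → F) ≃ₗ[F] (ι → F)) where
  carrier := {σ | IsMonomial σ ∧ C.map (σ : (ι → F) →ₗ[F] (ι → F)) = C}
  one_mem' := by
    refine ⟨⟨Equiv.refl _, fun _ => 1, fun x j => by simp⟩, ?_⟩
    ext x
    simp
  mul_mem' := by
    rintro σ τ ⟨⟨e, u, h⟩, hσ⟩ ⟨⟨f, v, k⟩, hτ⟩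
    refine ⟨⟨e.trans f, fun j => u j * v (e j), fun x j => ?_⟩, ?_⟩
    · simp [h, k, mul_assoc]
    · have : ((σ * τ : (ι → F) ≃ₗ[F] (ι → F)) : (ι → F) →ₗ[F] (ι → F))
          = (σ : (ι → F) →ₗ[F] (ι → F)).comp (τ : (ι → F) →ₗ[F] (ι → F)) := rfl
      rw [this, Submodule.map_comp, hτ, hσ]
  inv_mem' := by
    rintro σ ⟨⟨e, u, h⟩, hσ⟩
    refine ⟨⟨e.symm, fun j => (u (e.symm j))⁻¹, fun x j => ?_⟩, ?_⟩
    · have hx : σ (σ⁻¹ x) = x := σ.apply_symm_apply x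
      have := h (σ⁻¹ x) (e.symm j)
      rw [hx, e.apply_symm_apply] at this
      rw [this]
      simp
    · conv_lhs => rw [← hσ]
      ext x
      constructor
      · rintro ⟨_, ⟨y, hy, rfl⟩, rfl⟩
        have : σ⁻¹ (σ y) = y := σ.symm_apply_apply y
        simpa [this] using hy
      · intro hx
        exact ⟨σ x, ⟨x, hx, rfl⟩, σ.symm_apply_apply x⟩

/-- The action of the automorphism group on the cosets: `σ (v + C) = σ v + C`. -/
noncomputable instance cosetAction (C : Submodule F (ι → F)) : MulAction (autGroup C) ((ι → F) ⧸ C) where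
  smul σ := Submodule.Quotient.equiv C C σ.1 σ.2.2
  one_smul v := by
    obtain ⟨v, rfl⟩ := Submodule.Quotient.mk_surjective C v
    rfl
  mul_smul σ τ v := by
    obtain ⟨v, rfl⟩ := Submodule.Quotient.mk_surjective C v
    rfl

/-- Completely transitive: the automorphism group has exactly `ρ + 1` orbits on the cosets of
the code, where `ρ` is the covering radius. -/
def IsCompletelyTransitive [Fintype ι] [DecidableEq F] (C : Submodule F (ι → F)) : Prop :=
  Nat.card (MulAction.orbitRel.Quotient (autGroup C) ((ι → F) ⧸ C)) = coveringRadius C + 1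

/-- The `q`-repeated code: all `(a, x₁, …, xₘ)` with `a` arbitrary and `(x₁, …, xₘ)` in `C`. -/
def qRepeated {m : ℕ} (C : Submodule F (Fin m → F)) : Submodule F (Fin (m + 1) → F) :=
  C.comap (LinearMap.funLeft F F Fin.succ)

/-- The repetition code of all constant vectors. -/
def repetitionCode (F : Type*) [Field F] (n : ℕ) : Submodule F (Fin n → F) :=
  Submodule.span F {fun _ => 1}

/-- The rows of `G` form a basis of `C`. -/
def IsGeneratorMatrix (G : Matrix κ ι F) (C : Submodule F (ι → F)) : Prop :=
  LinearIndependent F G.row ∧ Submodule.span F (Set.range G.row) = C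

/-- The rows of `H` are linearly independent and `C` is the null space of `H`. -/
def IsParityCheckMatrix [Fintype ι] (H : Matrix κ ι F) (C : Submodule F (ι → F)) : Prop :=
  LinearIndependent F H.row ∧ ∀ x, x ∈ C ↔ H.mulVec x = 0

/-- Hamming code of redundancy `m ≥ 2`: the null space of a matrix whose columns
represent every one-dimensional subspace of `F ^ m` exactly once. -/
def IsHammingCode [Fintype ι] (m : ℕ) (C : Submodule F (ι → F)) : Prop :=
  2 ≤ m ∧ ∃ H : Matrix (Fin m) ι F,
    (∀ x, x ∈ C ↔ H.mulVec x = 0) ∧ (∀ j, H.col j ≠ 0) ∧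
      ∀ v : Fin m → F, v ≠ 0 → ∃! j, ∃ a : F, v = a • H.col j

end LinearCode

namespace LinearCode

/-! Replace C by its syndromes: the quotient `(ι → F) ⧸ C` with the images of the unit vectors,
which are the columns of a parity check matrix. For each syndrome, `colMult` counts the columns that
are nonzero multiples of it. For x outside C this is the number of codewords at distance 1, so
complete regularity with covering radius 1 forces a common multiplicity r > 0 on all nonzero
syndromes (`exists_colMult_eq`).

Conversely, a linear isomorphism of quotients that preserves multiplicities is induced by a monomial
map (`exists_monomial_lift`). Under constant multiplicity every automorphism of the quotient
qualifies, and these are transitive on nonzero vectors, whence complete transitivity. If there are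
also no zero columns, r and the dimension m of the quotient determine C up to equivalence
(`isEquivalent_of_colMult_eq`), so C need only be compared with a model having the same r and m.

The minimum distance is read off from the columns: d = 1 gives a zero column, which can be deleted;
d = 2 forces r > 1 and d = 3 forces r = 1; covering radius 1 excludes d > 3. Without zero columns,
counting gives n = r(q^m - 1)/(q - 1). -/

theorem map_eq_of_mk_comm {F : Type*} [Field F] {ι κ : Type*} {C : Submodule F (ι → F)}
    {D : Submodule F (κ → F)}
    {T : ((ι → F) ⧸ C) ≃ₗ[F] ((κ → F) ⧸ D)} {σ : (ι → F) ≃ₗ[F] (κ → F)}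
    (h : ∀ x, (Submodule.Quotient.mk (σ x) : (κ → F) ⧸ D) = T (Submodule.Quotient.mk x)) :
    C.map (σ : (ι → F) →ₗ[F] (κ → F)) = D := by
  have key : ∀ x, σ x ∈ D ↔ x ∈ C := fun x => by
    rw [← Submodule.Quotient.mk_eq_zero D, h, LinearEquiv.map_eq_zero_iff,
      Submodule.Quotient.mk_eq_zero]
  ext y
  constructor
  · rintro ⟨x, hx, rfl⟩
    exact (key x).2 hx
  · intro hy
    exact ⟨σ.symm y, (key _).1 (by simpa using hy), by simp⟩

theorem exists_linearEquiv_apply_eq {F : Type*} [Field F] {V : Type*} [AddCommGroup V]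
    [Module F V] {v w : V}
    (hv : v ≠ 0) (hw : w ≠ 0) : ∃ T : V ≃ₗ[F] V, T v = w := by
  obtain ⟨T, hT⟩ := Submodule.exists_linearEquiv_restrict_eq
    ((LinearEquiv.toSpanNonzeroSingleton F V v hv).symm.trans
      (LinearEquiv.toSpanNonzeroSingleton F V w hw))
  refine ⟨T, ?_⟩
  have h1 := hT ⟨v, Submodule.mem_span_singleton_self v⟩
  have h2 : (LinearEquiv.toSpanNonzeroSingleton F V v hv).symm
      ⟨v, Submodule.mem_span_singleton_self v⟩ = 1 := by
    rw [LinearEquiv.symm_apply_eq]; simp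
  rw [LinearEquiv.trans_apply, h2] at h1
  simpa using h1.symm

/-! ### Column multiplicities and monomial maps -/

section Multiplicity

variable {F : Type*} [Field F] {ι κ : Type*} [DecidableEq ι] [DecidableEq κ]

/-- The number of coordinates `j` such that `x` is congruent modulo `C` to a nonzero multiple of
the `j`-th unit vector. In terms of a parity check matrix, it counts the columns that are
nonzero multiples of the syndrome of `x`. -/
noncomputable def colMult (C : Submodule F (ι → F)) (x : ι → F) : ℕ :=
  Nat.card {j : ι // ∃ u : Fˣ, x - Pi.single j (u : F) ∈ C}

theorem single_unit_eq (j : ι) (u : Fˣ) :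
    (Pi.single j (u : F) : ι → F) = u • Pi.single j (1 : F) := by
  rw [← Pi.single_smul, Units.smul_def, smul_eq_mul, mul_one]

theorem single_unit_mem_iff {C : Submodule F (ι → F)} {j : ι} {u : Fˣ} :
    Pi.single j (u : F) ∈ C ↔ Pi.single j (1 : F) ∈ C := by
  rw [single_unit_eq, Units.smul_def, C.smul_mem_iff u.ne_zero]

/-- Two distinct scalars would put the j-th unit vector, and then x, into C. Hence counting
coordinates j is the same as counting pairs (j, u). -/
theorem unit_eq_of_sub_single_mem {C : Submodule F (ι → F)} {x : ι → F} (hx : x ∉ C) {j : ι}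
    {u v : Fˣ} (hu : x - Pi.single j (u : F) ∈ C) (hv : x - Pi.single j (v : F) ∈ C) : u = v := by
  by_contra huv
  have h1 := C.sub_mem hu hv
  rw [sub_sub_sub_cancel_left, ← Pi.single_sub] at h1
  have h2 : (v : F) - u ≠ 0 := sub_ne_zero.2 fun h => huv (Units.ext h.symm)
  have h3 := (single_unit_mem_iff (u := Units.mk0 _ h2)).1 h1
  have h4 := (single_unit_mem_iff (u := u)).2 h3
  exact hx (by simpa using C.add_mem hu h4)

theorem colMult_of_mem {C : Submodule F (ι → F)} {x : ι → F} (hx : x ∈ C) :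
    colMult C x = Nat.card {j : ι // Pi.single j (1 : F) ∈ C} := by
  refine Nat.card_congr (Equiv.subtypeEquivRight fun j => ?_)
  simp only [C.sub_mem_iff_right hx, single_unit_mem_iff, exists_const]

theorem colMult_pos_iff [Finite ι] {C : Submodule F (ι → F)} {x : ι → F} :
    0 < colMult C x ↔ ∃ (j : ι) (u : Fˣ), x - Pi.single j (u : F) ∈ C := by
  rw [colMult, Nat.card_pos_iff]
  simp only [nonempty_subtype, and_iff_left_iff_imp]
  exact fun _ => inferInstance

theorem colMult_eq_one_iff {C : Submodule F (ι → F)} {x : ι → F} :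
    colMult C x = 1 ↔ ∃! j, ∃ u : Fˣ, x - Pi.single j (u : F) ∈ C := by
  rw [colMult, Nat.card_eq_one_iff_unique, ← unique_subtype_iff_existsUnique,
    unique_iff_subsingleton_and_nonempty]

/-- A linear isomorphism of the spaces of syndromes that respects the multiplicities of the
columns is induced by a monomial map. -/
theorem exists_monomial_lift [Finite ι] [Finite κ] (C : Submodule F (ι → F))
    (D : Submodule F (κ → F)) (T : ((ι → F) ⧸ C) ≃ₗ[F] ((κ → F) ⧸ D))
    (h : ∀ x y, T (Submodule.Quotient.mk x) = Submodule.Quotient.mk y →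
      colMult C x = colMult D y) :
    ∃ σ : (ι → F) ≃ₗ[F] (κ → F), IsMonomial σ ∧
      ∀ x, (Submodule.Quotient.mk (σ x) : (κ → F) ⧸ D) = T (Submodule.Quotient.mk x) := by
  classical
  -- Sort the columns on both sides by their orbit under nonzero scalars. The fibre over the orbit
  -- of a syndrome has its multiplicity as cardinality; the zero orbit collects the zero columns.
  let p : ι → MulAction.orbitRel.Quotient Fˣ ((κ → F) ⧸ D) := fun i =>
    Quotient.mk'' (T (Submodule.Quotient.mk (Pi.single i 1)))
  let p' : κ → MulAction.orbitRel.Quotient Fˣ ((κ → F) ⧸ D) := fun j =>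
    Quotient.mk'' (Submodule.Quotient.mk (Pi.single j 1))
  have hcard : ∀ c, Nonempty ({i // p i = c} ≃ {j // p' j = c}) := by
    intro c
    induction c using Quotient.inductionOn' with | _ w
    obtain ⟨y, rfl⟩ := Submodule.Quotient.mk_surjective D w
    obtain ⟨x, hx⟩ := Submodule.Quotient.mk_surjective C (T.symm (Submodule.Quotient.mk y))
    have hxy : T (Submodule.Quotient.mk x) = Submodule.Quotient.mk y := by rw [hx]; simp
    refine Finite.card_eq.1 ?_
    have h1 : Nat.card {i // p i = Quotient.mk'' (Submodule.Quotient.mk y)} = colMult C x := by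
      refine Nat.card_congr (Equiv.subtypeEquivRight fun i => ?_)
      rw [eq_comm, Quotient.eq'', MulAction.orbitRel_apply, MulAction.mem_orbit_iff]
      refine exists_congr fun u => ?_
      rw [← hxy, single_unit_eq, ← Submodule.Quotient.eq, Units.smul_def, Units.smul_def,
        ← map_smul, T.injective.eq_iff, Submodule.Quotient.mk_smul, eq_comm]
    have h2 : Nat.card {j // p' j = Quotient.mk'' (Submodule.Quotient.mk y)} = colMult D y := by
      refine Nat.card_congr (Equiv.subtypeEquivRight fun j => ?_)
      rw [eq_comm, Quotient.eq'', MulAction.orbitRel_apply, MulAction.mem_orbit_iff]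
      refine exists_congr fun u => ?_
      rw [single_unit_eq, ← Submodule.Quotient.eq, Units.smul_def, Units.smul_def,
        Submodule.Quotient.mk_smul, eq_comm]
    rw [h1, h2, h x y hxy]
  -- Bijections between corresponding fibres glue to the coordinate permutation; the scalars then
  -- come from equality of orbits.
  let e : ι ≃ κ := Equiv.ofFiberEquiv fun c => (hcard c).some
  have he : ∀ i, p' (e i) = p i := fun i => Equiv.ofFiberEquiv_map _ i
  have hu : ∀ j, ∃ u : Fˣ, u • (Submodule.Quotient.mk (Pi.single j 1) : (κ → F) ⧸ D) =
      T (Submodule.Quotient.mk (Pi.single (e.symm j) 1)) := by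
    intro j
    have := (he (e.symm j)).symm
    rw [e.apply_symm_apply, Quotient.eq'', MulAction.orbitRel_apply,
      MulAction.mem_orbit_iff] at this
    exact this
  choose u hu using hu
  let σ : (ι → F) ≃ₗ[F] (κ → F) :=
    (LinearEquiv.funCongrLeft F F e.symm).trans (LinearEquiv.piCongrRight fun j =>
      LinearEquiv.smulOfUnit (u j))
  have hσ : ∀ x j, σ x j = (u j : F) * x (e.symm j) := fun x j => rfl
  refine ⟨σ, ⟨e.symm, u, hσ⟩, fun x => ?_⟩
  have hlin : D.mkQ ∘ₗ (σ : (ι → F) →ₗ[F] (κ → F)) =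
      (T : ((ι → F) ⧸ C) →ₗ[F] ((κ → F) ⧸ D)) ∘ₗ C.mkQ := by
    refine LinearMap.pi_ext' fun i => LinearMap.ext_ring ?_
    have h1 : σ (Pi.single i 1) = u (e i) • Pi.single (e i) (1 : F) := by
      ext j
      rw [hσ]
      by_cases hj : j = e i
      · subst hj; simp [Units.smul_def]
      · have : e.symm j ≠ i := fun hh => hj (by rw [← hh, e.apply_symm_apply])
        simp [Pi.single_eq_of_ne this, Pi.single_eq_of_ne hj]
    have h2 := hu (e i)
    rw [e.symm_apply_apply] at h2
    simp only [LinearMap.comp_apply, LinearMap.single_apply, LinearEquiv.coe_coe, h1,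
      Submodule.mkQ_apply, ← h2]
    rfl
  exact LinearMap.congr_fun hlin x

/-- Any linear isomorphism of the quotients lifts, since the multiplicity is r at each nonzero
syndrome and 0 at the zero syndrome on both sides. -/
theorem isEquivalent_of_colMult_eq [Finite ι] [Finite κ] {C : Submodule F (ι → F)}
    {D : Submodule F (κ → F)} {r : ℕ}
    (hrank : Module.finrank F ((ι → F) ⧸ C) = Module.finrank F ((κ → F) ⧸ D))
    (hC : ∀ x, x ∉ C → colMult C x = r) (hD : ∀ x, x ∉ D → colMult D x = r)
    (hC0 : ∀ j, Pi.single j (1 : F) ∉ C) (hD0 : ∀ j, Pi.single j (1 : F) ∉ D) :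
    IsEquivalent C D := by
  have T := LinearEquiv.ofFinrankEq _ _ hrank
  obtain ⟨σ, hσ, hT⟩ := exists_monomial_lift C D T fun x y hxy => by
    have hmem : x ∈ C ↔ y ∈ D := by
      rw [← Submodule.Quotient.mk_eq_zero, ← Submodule.Quotient.mk_eq_zero D, ← hxy,
        LinearEquiv.map_eq_zero_iff]
    by_cases hx : x ∈ C
    · rw [colMult_of_mem hx, colMult_of_mem (hmem.1 hx)]
      have : IsEmpty {j // Pi.single j (1 : F) ∈ C} := ⟨fun j => hC0 j.1 j.2⟩
      have : IsEmpty {j // Pi.single j (1 : F) ∈ D} := ⟨fun j => hD0 j.1 j.2⟩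
      simp
    · rw [hC x hx, hD y (fun hy => hx (hmem.2 hy))]
  exact ⟨σ, hσ, map_eq_of_mk_comm hT⟩

/-- If all syndromes outside the code have the same multiplicity, then the automorphism group is
transitive on the nonzero cosets. -/
theorem exists_autGroup_smul_eq [Finite ι] {C : Submodule F (ι → F)} {r : ℕ}
    (hC : ∀ x, x ∉ C → colMult C x = r) {v w : (ι → F) ⧸ C} (hv : v ≠ 0) (hw : w ≠ 0) :
    ∃ σ : autGroup C, σ • v = w := by
  obtain ⟨T, hT⟩ := exists_linearEquiv_apply_eq (F := F) hv hw
  obtain ⟨σ, hσ, hσT⟩ := exists_monomial_lift C C T fun x y hxy => by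
    have hmem : x ∈ C ↔ y ∈ C := by
      rw [← Submodule.Quotient.mk_eq_zero, ← Submodule.Quotient.mk_eq_zero C, ← hxy,
        LinearEquiv.map_eq_zero_iff]
    by_cases hx : x ∈ C
    · rw [colMult_of_mem hx, colMult_of_mem (hmem.1 hx)]
    · rw [hC x hx, hC y (fun hy => hx (hmem.2 hy))]
  refine ⟨⟨σ, hσ, map_eq_of_mk_comm hσT⟩, ?_⟩
  obtain ⟨x, rfl⟩ := Submodule.Quotient.mk_surjective C v
  rw [← hT, ← hσT]
  rfl

/-- The zero coset is fixed by linearity, and the nonzero cosets form a single orbit. -/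
theorem card_orbits_eq_two [Finite ι] {C : Submodule F (ι → F)} {r : ℕ} (hne : C ≠ ⊤)
    (hC : ∀ x, x ∉ C → colMult C x = r) :
    Nat.card (MulAction.orbitRel.Quotient (autGroup C) ((ι → F) ⧸ C)) = 2 := by
  obtain ⟨x, hx⟩ : ∃ x, x ∉ C := by
    by_contra! h
    exact hne (Submodule.eq_top_iff'.2 h)
  have hx0 : (Submodule.Quotient.mk x : (ι → F) ⧸ C) ≠ 0 := by
    rwa [Ne, Submodule.Quotient.mk_eq_zero]
  rw [Nat.card_eq_two_iff]
  refine ⟨Quotient.mk'' 0, Quotient.mk'' (Submodule.Quotient.mk x), ?_, ?_⟩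
  · rw [Ne, eq_comm, Quotient.eq'', MulAction.orbitRel_apply, MulAction.mem_orbit_iff]
    rintro ⟨σ, hσ⟩
    refine hx0 (hσ.symm.trans ?_)
    exact map_zero (Submodule.Quotient.equiv C C σ.1 σ.2.2)
  · refine Set.eq_univ_of_forall fun c => ?_
    induction c using Quotient.inductionOn' with | _ w
    by_cases hw : w = 0
    · left; rw [hw]
    · right
      rw [Set.mem_singleton_iff, Quotient.eq'', MulAction.orbitRel_apply,
        MulAction.mem_orbit_iff]
      exact exists_autGroup_smul_eq hC hx0 hw

end Multiplicity

/-! ### Distances, covering radius and complete regularity -/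

section Distance

variable {F : Type*} [Field F] [DecidableEq F] {ι : Type*} [Fintype ι]

theorem hammingDist_eq_hammingNorm_sub (x y : ι → F) :
    hammingDist x y = hammingNorm (x - y) := by
  rw [hammingDist_comm, hammingDist_eq_hammingNorm, neg_add_eq_sub]

theorem distTo_le {C : Submodule F (ι → F)} {c : ι → F} (hc : c ∈ C) (x : ι → F) :
    distTo C x ≤ hammingDist x c :=
  ciInf_le (OrderBot.bddBelow _) (⟨c, hc⟩ : C)

theorem exists_hammingDist_eq_distTo (C : Submodule F (ι → F)) (x : ι → F) :
    ∃ c ∈ C, hammingDist x c = distTo C x := by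
  obtain ⟨c, hc⟩ := Nat.sInf_mem (Set.range_nonempty fun c : C => hammingDist x (c : ι → F))
  exact ⟨c, c.2, hc⟩

theorem distTo_eq_zero_iff {C : Submodule F (ι → F)} {x : ι → F} : distTo C x = 0 ↔ x ∈ C := by
  constructor
  · intro h
    obtain ⟨c, hc, hx⟩ := exists_hammingDist_eq_distTo C x
    rw [h, hammingDist_eq_zero] at hx
    rwa [hx]
  · intro h
    simpa using distTo_le h x

theorem distTo_le_coveringRadius (C : Submodule F (ι → F)) (x : ι → F) :
    distTo C x ≤ coveringRadius C := by
  -- A supremum in ℕ is meaningful only for a bounded family; the length is a bound.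
  refine le_ciSup (f := fun x => distTo C x) ⟨Fintype.card ι, ?_⟩ x
  rintro _ ⟨y, rfl⟩
  exact (distTo_le C.zero_mem y).trans hammingDist_le_card_fintype

theorem ne_top_of_coveringRadius_eq_one {C : Submodule F (ι → F)} (h : coveringRadius C = 1) :
    C ≠ ⊤ := by
  rintro rfl
  have : ∀ x, distTo (⊤ : Submodule F (ι → F)) x = 0 := fun x => distTo_eq_zero_iff.2 trivial
  simp [coveringRadius, this] at h

theorem distTo_eq_one_of_coveringRadius {C : Submodule F (ι → F)} (h : coveringRadius C = 1)
    {x : ι → F} (hx : x ∉ C) : distTo C x = 1 := by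
  have h1 := distTo_le_coveringRadius C x
  have h2 : distTo C x ≠ 0 := fun h0 => hx (distTo_eq_zero_iff.1 h0)
  omega

theorem numAtDist_add_mem {C : Submodule F (ι → F)} {x c : ι → F} (hc : c ∈ C) (i : ℕ) :
    numAtDist C (x + c) i = numAtDist C x i := by
  refine Nat.card_congr ((Equiv.subRight c).subtypeEquiv fun y => ?_)
  change y ∈ C ∧ hammingDist (x + c) y = i ↔ y - c ∈ C ∧ hammingDist x (y - c) = i
  rw [C.sub_mem_iff_left hc, hammingDist_eq_hammingNorm_sub, hammingDist_eq_hammingNorm_sub,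
    sub_sub_eq_add_sub]

theorem IsMonomial.hammingDist_eq {κ : Type*} [Fintype κ] {σ : (ι → F) ≃ₗ[F] (κ → F)}
    (h : IsMonomial σ) (x y : ι → F) : hammingDist (σ x) (σ y) = hammingDist x y := by
  obtain ⟨e, u, hu⟩ := h
  refine Finset.card_bij' (fun j _ => e j) (fun i _ => e.symm i) ?_ ?_ ?_ ?_ <;> simp [hu]

theorem numAtDist_monomial {C : Submodule F (ι → F)} {σ : (ι → F) ≃ₗ[F] (ι → F)}
    (h : IsMonomial σ) (hC : C.map (σ : (ι → F) →ₗ[F] (ι → F)) = C) (x : ι → F) (i : ℕ) :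
    numAtDist C (σ x) i = numAtDist C x i := by
  symm
  refine Nat.card_congr (σ.toEquiv.subtypeEquiv fun y => ?_)
  have hy : σ y ∈ C ↔ y ∈ C := by
    conv_lhs => rw [← hC]
    constructor
    · rintro ⟨z, hz, hzy⟩
      rwa [← σ.injective hzy]
    · exact fun hy => ⟨y, hy, rfl⟩
  simp [hy, h.hammingDist_eq]

variable [DecidableEq ι]

theorem hammingNorm_single_le (j : ι) (a : F) : hammingNorm (Pi.single j a : ι → F) ≤ 1 := by
  refine Finset.card_le_one.2 fun i hi k hk => ?_
  simp only [Finset.mem_filter, Finset.mem_univ, true_and, Pi.single_apply, ne_eq,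
    ite_eq_right_iff, Classical.not_imp] at hi hk
  rw [hi.1, hk.1]

theorem hammingNorm_single_unit (j : ι) (u : Fˣ) :
    hammingNorm (Pi.single j (u : F) : ι → F) = 1 := by
  refine le_antisymm (hammingNorm_single_le j _) (hammingNorm_pos_iff.2 ?_)
  simp

theorem hammingNorm_eq_one_iff {y : ι → F} :
    hammingNorm y = 1 ↔ ∃ (j : ι) (u : Fˣ), y = Pi.single j (u : F) := by
  constructor
  · intro h
    obtain ⟨j, hj⟩ := Finset.card_eq_one.1 h
    have hj' : ∀ i, y i ≠ 0 ↔ i = j := fun i => by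
      simpa using Finset.ext_iff.1 hj i
    refine ⟨j, Units.mk0 (y j) ((hj' j).2 rfl), funext fun i => ?_⟩
    by_cases hi : i = j
    · subst hi; simp
    · rw [Pi.single_eq_of_ne hi]
      exact not_not.1 fun h0 => hi ((hj' i).1 h0)
  · rintro ⟨j, u, rfl⟩
    exact hammingNorm_single_unit j u

theorem colMult_pos_of_coveringRadius {C : Submodule F (ι → F)} (h : coveringRadius C = 1)
    {x : ι → F} (hx : x ∉ C) : 0 < colMult C x := by
  obtain ⟨c, hc, hxc⟩ := exists_hammingDist_eq_distTo C x
  rw [distTo_eq_one_of_coveringRadius h hx, hammingDist_eq_hammingNorm_sub,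
    hammingNorm_eq_one_iff] at hxc
  obtain ⟨j, u, hju⟩ := hxc
  refine colMult_pos_iff.2 ⟨j, u, ?_⟩
  rwa [← hju, sub_sub_cancel]

theorem coveringRadius_eq_one {C : Submodule F (ι → F)} (hne : C ≠ ⊤)
    (h : ∀ x, x ∉ C → 0 < colMult C x) : coveringRadius C = 1 := by
  have hle : coveringRadius C ≤ 1 := by
    refine ciSup_le fun x => ?_
    by_cases hx : x ∈ C
    · rw [distTo_eq_zero_iff.2 hx]; exact zero_le_one
    · obtain ⟨j, u, hju⟩ := colMult_pos_iff.1 (h x hx)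
      refine (distTo_le hju x).trans ?_
      rw [hammingDist_eq_hammingNorm_sub]
      simpa using hammingNorm_single_le j (u : F)
  obtain ⟨x, hx⟩ : ∃ x, x ∉ C := by
    by_contra! h
    exact hne (Submodule.eq_top_iff'.2 h)
  have h2 : distTo C x ≠ 0 := fun h0 => hx (distTo_eq_zero_iff.1 h0)
  have := distTo_le_coveringRadius C x
  omega

/-- A codeword at distance 1 is x minus a nonzero multiple of a unit vector, and for x outside C the
coordinate determines the scalar. -/
theorem numAtDist_one_eq_colMult {C : Submodule F (ι → F)} {x : ι → F} (hx : x ∉ C) :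
    numAtDist C x 1 = colMult C x := by
  symm
  refine Nat.card_congr (Equiv.ofBijective (fun j : {j : ι // ∃ u : Fˣ,
    x - Pi.single j (u : F) ∈ C} => ⟨x - Pi.single j.1 (j.2.choose : F),
    j.2.choose_spec, ?_⟩) ⟨?_, ?_⟩)
  · rw [hammingDist_eq_hammingNorm_sub]
    simpa using hammingNorm_single_unit j.1 _
  · rintro ⟨i, hi⟩ ⟨j, hj⟩ hij
    simp only [Subtype.mk.injEq, sub_right_inj] at hij ⊢
    by_contra hne
    have := congrFun hij i
    rw [Pi.single_eq_same, Pi.single_eq_of_ne hne] at this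
    exact hi.choose.ne_zero this
  · rintro ⟨c, hc, hxc⟩
    rw [hammingDist_eq_hammingNorm_sub, hammingNorm_eq_one_iff] at hxc
    obtain ⟨j, u, hju⟩ := hxc
    have hc' : c = x - Pi.single j (u : F) := by
      rw [← hju]; abel
    have hj : ∃ u : Fˣ, x - Pi.single j (u : F) ∈ C := ⟨u, hc' ▸ hc⟩
    refine ⟨⟨j, hj⟩, Subtype.ext ?_⟩
    have := unit_eq_of_sub_single_mem hx hj.choose_spec (hc' ▸ hc)
    simp only [this, hc']

/-- Some automorphism carries the coset of x to that of y, and distance counts are invariant under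
automorphisms and under translation by C. This gives regularity of the shortened code when d = 1. -/
theorem isCompletelyRegular_of_colMult {C : Submodule F (ι → F)} {r : ℕ}
    (hC : ∀ x, x ∉ C → colMult C x = r) : IsCompletelyRegular C := by
  intro x y hxy i
  have hmem : x ∈ C ↔ y ∈ C := by rw [← distTo_eq_zero_iff, hxy, distTo_eq_zero_iff]
  by_cases hx : x ∈ C
  · rw [← zero_add x, ← zero_add y, numAtDist_add_mem hx, numAtDist_add_mem (hmem.1 hx)]
  · have hy : y ∉ C := fun h => hx (hmem.2 h)
    obtain ⟨σ, hσ⟩ := exists_autGroup_smul_eq hC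
      (v := Submodule.Quotient.mk x) (w := Submodule.Quotient.mk y)
      (by rwa [Ne, Submodule.Quotient.mk_eq_zero]) (by rwa [Ne, Submodule.Quotient.mk_eq_zero])
    have h1 : y - σ.1 x ∈ C := (Submodule.Quotient.eq C).1 hσ.symm
    rw [← numAtDist_monomial σ.2.1 σ.2.2 x, ← numAtDist_add_mem h1, add_sub_cancel]

/-- All vectors outside C have distance 1 from C, so regularity at i = 1 already suffices. -/
theorem exists_colMult_eq {C : Submodule F (ι → F)} (hCR : IsCompletelyRegular C)
    (hρ : coveringRadius C = 1) : ∃ r, 0 < r ∧ ∀ x, x ∉ C → colMult C x = r := by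
  obtain ⟨x₀, hx₀⟩ : ∃ x, x ∉ C := by
    by_contra! h
    exact ne_top_of_coveringRadius_eq_one hρ (Submodule.eq_top_iff'.2 h)
  refine ⟨colMult C x₀, colMult_pos_of_coveringRadius hρ hx₀, fun x hx => ?_⟩
  rw [← numAtDist_one_eq_colMult hx, ← numAtDist_one_eq_colMult hx₀]
  exact hCR _ _ (by rw [distTo_eq_one_of_coveringRadius hρ hx,
    distTo_eq_one_of_coveringRadius hρ hx₀]) 1

end Distance

/-! ### Minimum distance in terms of columns -/

section MinimumDistance

variable {F : Type*} [Field F] [DecidableEq F] {ι : Type*} [Fintype ι]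

theorem hammingNorm_sub_le (x y : ι → F) :
    hammingNorm (x - y) ≤ hammingNorm x + hammingNorm y := by
  rw [← hammingDist_eq_hammingNorm_sub, ← hammingDist_zero_right x, ← hammingDist_zero_right y]
  exact hammingDist_triangle_right x y 0

theorem minDist_le_hammingNorm {C : Submodule F (ι → F)} {c : ι → F} (hc : c ∈ C) (h0 : c ≠ 0) :
    minDist C ≤ hammingNorm c :=
  Nat.sInf_le ⟨c, hc, 0, C.zero_mem, h0, hammingDist_zero_right c⟩

theorem exists_hammingNorm_eq_minDist {C : Submodule F (ι → F)} (h : C ≠ ⊥) :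
    ∃ c ∈ C, c ≠ 0 ∧ hammingNorm c = minDist C := by
  obtain ⟨c, hc, h0⟩ := C.exists_mem_ne_zero_of_ne_bot h
  obtain ⟨x, hx, y, hy, hxy, hd⟩ := Nat.sInf_mem
    (s := {t | ∃ x ∈ C, ∃ y ∈ C, x ≠ y ∧ hammingDist x y = t})
    ⟨_, c, hc, 0, C.zero_mem, h0, rfl⟩
  exact ⟨x - y, C.sub_mem hx hy, sub_ne_zero.2 hxy, by
    rw [← hammingDist_eq_hammingNorm_sub, hd, minDist]⟩

theorem minDist_bot : minDist (⊥ : Submodule F (ι → F)) = 0 := by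
  have : {t | ∃ x ∈ (⊥ : Submodule F (ι → F)), ∃ y ∈ (⊥ : Submodule F (ι → F)),
      x ≠ y ∧ hammingDist x y = t} = ∅ := by
    refine Set.eq_empty_of_forall_notMem ?_
    rintro t ⟨x, hx, y, hy, hxy, -⟩
    exact hxy (((Submodule.mem_bot F).1 hx).trans ((Submodule.mem_bot F).1 hy).symm)
  rw [minDist, this, Nat.sInf_empty]

theorem ne_bot_of_minDist_pos {C : Submodule F (ι → F)} (h : 0 < minDist C) : C ≠ ⊥ := by
  rintro rfl
  rw [minDist_bot] at h
  exact lt_irrefl _ h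

/-- The all-one vector is at distance n from 0, so n ≤ 1; for n = 0 the zero code is the whole
space. -/
theorem card_eq_one_of_coveringRadius_bot
    (hρ : coveringRadius (⊥ : Submodule F (ι → F)) = 1) : Fintype.card ι = 1 := by
  have h1 : hammingNorm (fun _ : ι => (1 : F)) = Fintype.card ι := by
    simp [hammingNorm]
  have h2 := distTo_le_coveringRadius (⊥ : Submodule F (ι → F)) fun _ => 1
  obtain ⟨c, hc, hd⟩ := exists_hammingDist_eq_distTo (⊥ : Submodule F (ι → F)) fun _ => 1
  rw [(Submodule.mem_bot F).1 hc, hammingDist_zero_right, h1] at hd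
  have h3 : Fintype.card ι ≠ 0 := fun h0 => by
    have := Fintype.card_eq_zero_iff.1 h0
    exact ne_top_of_coveringRadius_eq_one hρ (Subsingleton.elim _ _)
  omega

variable [DecidableEq ι]

theorem exists_single_mem_of_minDist_eq_one {C : Submodule F (ι → F)} (h : minDist C = 1) :
    ∃ j, Pi.single j (1 : F) ∈ C := by
  obtain ⟨c, hc, -, hd⟩ := exists_hammingNorm_eq_minDist (ne_bot_of_minDist_pos (h ▸ one_pos))
  rw [h, hammingNorm_eq_one_iff] at hd
  obtain ⟨j, u, rfl⟩ := hd
  exact ⟨j, single_unit_mem_iff.1 hc⟩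

theorem single_notMem_of_one_lt_minDist {C : Submodule F (ι → F)} (h : 1 < minDist C) (j : ι) :
    Pi.single j (1 : F) ∉ C := fun hj =>
  absurd ((minDist_le_hammingNorm hj (by simp)).trans (hammingNorm_single_le j 1)) (by omega)

/-- A codeword of weight 2 makes two columns proportional, so the syndrome of one of them is counted
at both coordinates of the support. -/
theorem one_lt_of_minDist_eq_two {C : Submodule F (ι → F)} (h : minDist C = 2) {r : ℕ}
    (hC : ∀ x, x ∉ C → colMult C x = r) : 1 < r := by
  obtain ⟨c, hc, -, hd⟩ := exists_hammingNorm_eq_minDist (ne_bot_of_minDist_pos (h ▸ two_pos))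
  rw [h] at hd
  obtain ⟨i, j, hij, hs⟩ := Finset.card_eq_two.1 hd
  have hs' : ∀ l, c l ≠ 0 ↔ l = i ∨ l = j := fun l => by
    simpa using Finset.ext_iff.1 hs l
  have hci : c i ≠ 0 := (hs' i).2 (Or.inl rfl)
  have hcj : c j ≠ 0 := (hs' j).2 (Or.inr rfl)
  have hc' : c = Pi.single i (c i) - Pi.single j (-c j) := by
    ext l
    by_cases hli : l = i
    · subst hli; simp [hij]
    · by_cases hlj : l = j
      · subst hlj; simp [hli]
      · have : c l = 0 := not_not.1 fun h0 => ((hs' l).1 h0).elim hli hlj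
        simp [hli, hlj, this]
  have hx : (Pi.single i (c i) : ι → F) ∉ C := fun hx =>
    single_notMem_of_one_lt_minDist (h ▸ one_lt_two) i
      ((single_unit_mem_iff (u := Units.mk0 _ hci)).1 hx)
  rw [← hC _ hx, colMult, Finite.one_lt_card_iff_nontrivial]
  refine ⟨⟨i, Units.mk0 _ hci, by simp⟩, ⟨j, Units.mk0 _ (neg_ne_zero.2 hcj), ?_⟩, ?_⟩
  · rw [Units.val_mk0, ← hc']
    exact hc
  · simpa using hij

theorem colMult_le_one_of_two_lt_minDist {C : Submodule F (ι → F)} (h : 2 < minDist C)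
    (x : ι → F) : colMult C x ≤ 1 := by
  rw [colMult, Finite.card_le_one_iff_subsingleton]
  refine ⟨?_⟩
  rintro ⟨i, u, hi⟩ ⟨j, v, hj⟩
  by_contra hij
  have hij : i ≠ j := fun h => hij (Subtype.ext h)
  have h1 := C.sub_mem hi hj
  rw [sub_sub_sub_cancel_left] at h1
  have h2 : (Pi.single j (v : F) - Pi.single i (u : F) : ι → F) ≠ 0 := fun h0 => by
    have := congrFun h0 i
    simp [hij] at this
  have := minDist_le_hammingNorm h1 h2
  have := hammingNorm_sub_le (Pi.single j (v : F)) (Pi.single i (u : F))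
  have := hammingNorm_single_le j (v : F)
  have := hammingNorm_single_le i (u : F)
  omega

/-- A difference of two unit vectors has weight 2 and lies within distance 1 of C. Changing one
coordinate cannot cancel both entries, so a nonzero codeword of weight at most 3 results. -/
theorem minDist_le_three {C : Submodule F (ι → F)} (hρ : coveringRadius C = 1) (hC : C ≠ ⊥) :
    minDist C ≤ 3 := by
  obtain ⟨c, hc, h0, hd⟩ := exists_hammingNorm_eq_minDist hC
  by_contra! hlt
  obtain ⟨i, hi, j, hj, hij⟩ : ∃ i ∈ Finset.univ.filter (fun l => c l ≠ 0),
      ∃ j ∈ Finset.univ.filter (fun l => c l ≠ 0), i ≠ j :=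
    Finset.one_lt_card.1 (by change 1 < hammingNorm c; omega)
  have hxn : hammingNorm (Pi.single i (1 : F) - Pi.single j (1 : F)) ≤ 2 :=
    (hammingNorm_sub_le _ _).trans
      (add_le_add (hammingNorm_single_le i 1) (hammingNorm_single_le j 1))
  have hxi : (Pi.single i (1 : F) - Pi.single j (1 : F) : ι → F) i = 1 := by simp [hij]
  have hxj : (Pi.single i (1 : F) - Pi.single j (1 : F) : ι → F) j = -1 := by simp [hij.symm]
  -- Only the weight bound and the two nonzero entries matter from here on.
  generalize (Pi.single i (1 : F) - Pi.single j (1 : F) : ι → F) = x at hxn hxi hxj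
  by_cases hx : x ∈ C
  · have := minDist_le_hammingNorm hx fun h => by simp [h] at hxi
    omega
  · obtain ⟨l, u, hl⟩ := colMult_pos_iff.1 (colMult_pos_of_coveringRadius hρ hx)
    have h1 := hammingNorm_sub_le x (Pi.single l (u : F))
    have h2 := hammingNorm_single_le l (u : F)
    have h3 := minDist_le_hammingNorm hl fun h => by
      by_cases hil : i = l
      · have := congrFun h j
        simp [hxj, ← hil, hij.symm] at this
      · have := congrFun h i
        simp [hxi, hil] at this
    omega

end MinimumDistance

/-! ### Possible minimum distances and deletion of a zero column -/

theorem minDist_cases {F : Type*} [Field F] [DecidableEq F] {n : ℕ}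
    {C : Submodule F (Fin n → F)} (hρ : coveringRadius C = 1) :
    (n = 1 ∧ C = ⊥) ∨ minDist C = 1 ∨ minDist C = 2 ∨ minDist C = 3 := by
  by_cases hC : C = ⊥
  · subst hC
    exact Or.inl ⟨by simpa using card_eq_one_of_coveringRadius_bot hρ, rfl⟩
  · obtain ⟨c, hc, h0, hd⟩ := exists_hammingNorm_eq_minDist hC
    have h1 := minDist_le_three hρ hC
    have h2 := hammingNorm_pos_iff.2 h0
    omega

/-- The coordinate `j₀` is a zero column. Deleting it changes no multiplicity of a nonzero syndrome,
so the shorter code has the same constant r, which yields its regularity and covering radius. -/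
theorem exists_qRepeated {F : Type*} [Field F] [DecidableEq F] {n r : ℕ}
    {C : Submodule F (Fin n → F)} (hne : C ≠ ⊤) (hr : 0 < r)
    (hC : ∀ x, x ∉ C → colMult C x = r) {j₀ : Fin n} (hj₀ : Pi.single j₀ (1 : F) ∈ C) :
    ∃ (m : ℕ) (C' : Submodule F (Fin m → F)) (e : Fin n ≃ Fin (m + 1)),
      C = (qRepeated C').map (LinearMap.funLeft F F e) ∧
      IsCompletelyRegular C' ∧ coveringRadius C' = 1 := by
  obtain ⟨m, rfl⟩ : ∃ m, n = m + 1 := ⟨n - 1, by have := j₀.pos; omega⟩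
  let e : Fin (m + 1) ≃ Fin (m + 1) := Equiv.swap j₀ 0
  have he0 : e j₀ = 0 := Equiv.swap_apply_left _ _
  -- `ψ` inserts a zero at position `j₀`; the shorter code is the preimage of C.
  let ψ : (Fin m → F) →ₗ[F] (Fin (m + 1) → F) :=
    { toFun := fun x i => (Fin.cons 0 x : Fin (m + 1) → F) (e i)
      map_add' := fun x y => by
        ext i
        simp only [Pi.add_apply]
        generalize e i = k
        refine Fin.cases ?_ (fun l => ?_) k <;> simp
      map_smul' := fun a x => by
        ext i
        simp only [Pi.smul_apply, RingHom.id_apply]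
        generalize e i = k
        refine Fin.cases ?_ (fun l => ?_) k <;> simp }
  have hψ : ∀ x i, ψ x i = (Fin.cons 0 x : Fin (m + 1) → F) (e i) := fun _ _ => rfl
  have hψs : ∀ l (a : F), ψ (Pi.single l a) = Pi.single (e.symm l.succ) a := by
    intro l a
    ext i
    rw [hψ]
    obtain ⟨k, rfl⟩ := e.symm.surjective i
    rw [e.apply_symm_apply]
    refine Fin.cases ?_ (fun k => ?_) k
    · simp [(Fin.succ_ne_zero l).symm]
    · simp [Pi.single_apply]
  let C' := C.comap ψ
  have hmem : ∀ y : Fin (m + 1) → F, y ∘ Fin.succ ∈ C' ↔ y ∘ e ∈ C := by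
    intro y
    have h1 : y ∘ e - ψ (y ∘ Fin.succ) = y 0 • Pi.single j₀ (1 : F) := by
      ext i
      obtain ⟨k, rfl⟩ := e.symm.surjective i
      simp only [Pi.sub_apply, hψ, Function.comp_apply, e.apply_symm_apply, Pi.smul_apply,
        smul_eq_mul, Pi.single_apply, e.symm_apply_eq, he0]
      refine Fin.cases ?_ (fun k => ?_) k <;> simp
    have h2 : y ∘ e - ψ (y ∘ Fin.succ) ∈ C := h1 ▸ C.smul_mem _ hj₀
    rw [Submodule.mem_comap]
    exact ⟨fun h => by simpa using C.add_mem h2 h, fun h => by simpa using C.sub_mem h h2⟩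
  have hC' : ∀ x, x ∉ C' → colMult C' x = r := by
    intro x hx
    rw [← hC (ψ x) hx]
    refine Nat.card_congr (Equiv.ofBijective (fun l : {l // ∃ u : Fˣ,
      x - Pi.single l (u : F) ∈ C'} => ⟨e.symm l.1.succ, ?_⟩) ⟨?_, ?_⟩)
    · obtain ⟨l, u, hl⟩ := l
      refine ⟨u, ?_⟩
      rwa [Submodule.mem_comap, map_sub, hψs] at hl
    · rintro ⟨l, hl⟩ ⟨k, hk⟩ hlk
      simpa using hlk
    · rintro ⟨i, u, hi⟩
      obtain ⟨k, rfl⟩ := e.symm.surjective i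
      -- Index 0 corresponds to `j₀`, a zero column, which cannot be a multiple of a nonzero
      -- syndrome.
      have hk : k ≠ 0 := by
        rintro rfl
        rw [← he0, e.symm_apply_apply] at hi
        have := C.add_mem hi ((single_unit_mem_iff (u := u)).2 hj₀)
        rw [sub_add_cancel] at this
        exact hx this
      obtain ⟨l, rfl⟩ := Fin.exists_succ_eq.2 hk
      refine ⟨⟨l, u, ?_⟩, rfl⟩
      rwa [Submodule.mem_comap, map_sub, hψs]
  refine ⟨m, C', e, ?_, isCompletelyRegular_of_colMult hC',
    coveringRadius_eq_one ?_ fun x hx => (hC' x hx).symm ▸ hr⟩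
  · ext x
    rw [Submodule.mem_map]
    constructor
    · intro hx
      refine ⟨x ∘ e.symm, (hmem (x ∘ e.symm)).2 ?_, ?_⟩
      · simpa [Function.comp_assoc] using hx
      · ext i; simp [LinearMap.funLeft_apply]
    · rintro ⟨y, hy, rfl⟩
      exact (hmem y).1 hy
  · intro htop
    refine hne (Submodule.eq_top_iff'.2 fun x => ?_)
    have := (hmem (x ∘ e.symm)).1 (htop ▸ Submodule.mem_top)
    simpa [Function.comp_assoc] using this

open scoped LinearAlgebra.Projectivization

/-! ### Parity check matrices and Hamming codes -/

section ParityCheck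

variable {F : Type*} [Field F] {ι κ : Type*} [Fintype ι]

theorem IsParityCheckMatrix.mulVec_surjective [Fintype κ] {H : Matrix κ ι F}
    {C : Submodule F (ι → F)} (h : IsParityCheckMatrix H C) : Function.Surjective H.mulVec := by
  have h1 : LinearMap.range H.mulVecLin = ⊤ := by
    refine Submodule.eq_top_of_finrank_eq ?_
    rw [Module.finrank_fintype_fun_eq_card]
    exact h.1.rank_matrix
  exact LinearMap.range_eq_top.1 h1

theorem IsParityCheckMatrix.finrank_quotient [Fintype κ] {H : Matrix κ ι F}
    {C : Submodule F (ι → F)} (h : IsParityCheckMatrix H C) :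
    Module.finrank F ((ι → F) ⧸ C) = Fintype.card κ := by
  have hC : LinearMap.ker H.mulVecLin = C := by
    ext x
    rw [LinearMap.mem_ker, Matrix.mulVecLin_apply, h.2]
  subst hC
  rw [(H.mulVecLin.quotKerEquivOfSurjective h.mulVec_surjective).finrank_eq,
    Module.finrank_fintype_fun_eq_card]

theorem exists_isParityCheckMatrix (C : Submodule F (ι → F)) :
    ∃ H : Matrix (Fin (Module.finrank F ((ι → F) ⧸ C))) ι F, IsParityCheckMatrix H C := by
  classical
  let φ : (ι → F) →ₗ[F] (Fin (Module.finrank F ((ι → F) ⧸ C)) → F) :=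
    (Module.finBasis F ((ι → F) ⧸ C)).equivFun.toLinearMap ∘ₗ C.mkQ
  have hφ : Function.Surjective φ :=
    (Module.finBasis F ((ι → F) ⧸ C)).equivFun.surjective.comp C.mkQ_surjective
  have hmul : ∀ x, (LinearMap.toMatrix' φ).mulVec x = φ x := fun x =>
    LinearMap.toMatrix'_mulVec φ x
  refine ⟨LinearMap.toMatrix' φ, ?_, fun x => ?_⟩
  · rw [← Matrix.vecMul_injective_iff]
    refine (injective_iff_map_eq_zero (LinearMap.toMatrix' φ).vecMulLinear).2 fun w hw => ?_
    refine dotProduct_eq_zero w fun v => ?_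
    obtain ⟨x, rfl⟩ := hφ v
    rw [← hmul, Matrix.dotProduct_mulVec]
    have : Matrix.vecMul w (LinearMap.toMatrix' φ) = 0 := hw
    rw [this, zero_dotProduct]
  · rw [hmul]
    simp [φ]

theorem sub_single_mem_iff [DecidableEq ι] {H : Matrix κ ι F} {C : Submodule F (ι → F)}
    (h : ∀ x, x ∈ C ↔ H.mulVec x = 0) {x : ι → F} {j : ι} {a : F} :
    x - Pi.single j a ∈ C ↔ H.mulVec x = a • H.col j := by
  rw [h, Matrix.mulVec_sub, sub_eq_zero]
  have : H.mulVec (Pi.single j a) = a • H.col j := by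
    rw [Matrix.mulVec_single]
    ext i
    simp [mul_comm]
  rw [this]

theorem single_mem_iff [DecidableEq ι] {H : Matrix κ ι F} {C : Submodule F (ι → F)}
    (h : ∀ x, x ∈ C ↔ H.mulVec x = 0) {j : ι} : Pi.single j (1 : F) ∈ C ↔ H.col j = 0 := by
  rw [h, Matrix.mulVec_single_one]

theorem exists_unit_sub_single_mem_iff [DecidableEq ι] {H : Matrix κ ι F}
    {C : Submodule F (ι → F)} (h : ∀ x, x ∈ C ↔ H.mulVec x = 0) {x : ι → F} (hx : x ∉ C) {j : ι} :
    (∃ u : Fˣ, x - Pi.single j (u : F) ∈ C) ↔ ∃ a : F, H.mulVec x = a • H.col j := by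
  constructor
  · rintro ⟨u, hu⟩
    exact ⟨u, (sub_single_mem_iff h).1 hu⟩
  · rintro ⟨a, ha⟩
    have ha0 : a ≠ 0 := by
      rintro rfl
      rw [zero_smul] at ha
      exact hx ((h x).2 ha)
    exact ⟨Units.mk0 a ha0, (sub_single_mem_iff h).2 ha⟩

theorem IsHammingCode.colMult_eq_one [DecidableEq ι] {m : ℕ} {C : Submodule F (ι → F)}
    (h : IsHammingCode m C) {x : ι → F} (hx : x ∉ C) : colMult C x = 1 := by
  obtain ⟨-, H, hH, -, hcol⟩ := h
  rw [colMult_eq_one_iff]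
  simp only [exists_unit_sub_single_mem_iff hH hx]
  exact hcol _ fun h0 => hx ((hH x).2 h0)

theorem IsHammingCode.single_notMem [DecidableEq ι] {m : ℕ} {C : Submodule F (ι → F)}
    (h : IsHammingCode m C) (j : ι) : Pi.single j (1 : F) ∉ C := by
  obtain ⟨-, H, hH, hcol, -⟩ := h
  rw [single_mem_iff hH]
  exact hcol j

/-- Independent rows make every vector a syndrome, so multiplicity one says that each line is
represented by exactly one column. -/
theorem IsParityCheckMatrix.isHammingCode [DecidableEq ι] {m : ℕ} (hm : 2 ≤ m)
    {H : Matrix (Fin m) ι F} {C : Submodule F (ι → F)} (h : IsParityCheckMatrix H C)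
    (hC : ∀ x, x ∉ C → colMult C x = 1) (h0 : ∀ j, Pi.single j (1 : F) ∉ C) :
    IsHammingCode m C := by
  refine ⟨hm, H, h.2, fun j hj => h0 j ((single_mem_iff h.2).2 hj), fun v hv => ?_⟩
  obtain ⟨x, rfl⟩ := h.mulVec_surjective v
  have hx : x ∉ C := fun hx => hv ((h.2 x).1 hx)
  have := colMult_eq_one_iff.1 (hC x hx)
  simpa only [exists_unit_sub_single_mem_iff h.2 hx] using this

end ParityCheck

/-! ### Length formula and existence of Hamming codes -/

section Counting

variable {F : Type*} [Field F] {ι : Type*} [Fintype ι] [DecidableEq ι]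

/-- Double counting of the pairs formed by a column and a nonzero scalar. -/
theorem card_eq_mul_card_projectivization [Finite F] {C : Submodule F (ι → F)} {r : ℕ}
    (hC : ∀ x, x ∉ C → colMult C x = r) (h0 : ∀ j, Pi.single j (1 : F) ∉ C) :
    Fintype.card ι = r * Nat.card (ℙ F ((ι → F) ⧸ C)) := by
  have : Finite ((ι → F) ⧸ C) := Finite.of_surjective _ C.mkQ_surjective
  -- Send (j, u) to the coset of u times the j-th unit vector. Each nonzero coset has exactly r
  -- preimages, because the scalar is determined by j.
  let f : ι × Fˣ → {v : (ι → F) ⧸ C // v ≠ 0} := fun p =>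
    ⟨Submodule.Quotient.mk (Pi.single p.1 (p.2 : F)), fun h =>
      h0 p.1 (single_unit_mem_iff.1 ((Submodule.Quotient.mk_eq_zero C).1 h))⟩
  have hf : ∀ v, Nonempty ({p // f p = v} ≃ Fin r) := by
    rintro ⟨v, hv⟩
    obtain ⟨x, rfl⟩ := Submodule.Quotient.mk_surjective C v
    have hx : x ∉ C := fun h => hv ((Submodule.Quotient.mk_eq_zero C).2 h)
    rw [← Finite.card_eq, Nat.card_fin, ← hC x hx]
    have hp : ∀ p : ι × Fˣ, f p = ⟨Submodule.Quotient.mk x, hv⟩ ↔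
        x - Pi.single p.1 (p.2 : F) ∈ C := fun p => by
      rw [Subtype.mk.injEq, eq_comm, Submodule.Quotient.eq]
    refine Nat.card_congr (Equiv.ofBijective (fun p => ⟨p.1.1, p.1.2, (hp _).1 p.2⟩) ⟨?_, ?_⟩)
    · rintro ⟨⟨i, u⟩, hi⟩ ⟨⟨j, v⟩, hj⟩ hij
      obtain rfl : i = j := congrArg Subtype.val hij
      exact Subtype.ext (Prod.ext rfl
        (unit_eq_of_sub_single_mem hx ((hp (i, u)).1 hi) ((hp (i, v)).1 hj)))
    · rintro ⟨j, u, hj⟩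
      exact ⟨⟨(j, u), (hp _).2 hj⟩, rfl⟩
  have hcard : Nat.card (ι × Fˣ) = Nat.card ({v : (ι → F) ⧸ C // v ≠ 0} × Fin r) :=
    Nat.card_congr ((Equiv.sigmaFiberEquiv f).symm.trans
      ((Equiv.sigmaCongrRight fun v => (hf v).some).trans (Equiv.sigmaEquivProd _ _)))
  rw [Nat.card_prod, Nat.card_prod, Nat.card_fin, Nat.card_eq_fintype_card,
    Nat.card_congr (Projectivization.nonZeroEquivProjectivizationProdUnits F ((ι → F) ⧸ C)),
    Nat.card_prod] at hcard
  have hpos : 0 < Nat.card Fˣ := Nat.card_pos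
  refine Nat.eq_of_mul_eq_mul_right hpos ?_
  rw [hcard]
  ring

end Counting

theorem natCard_projectivization {F : Type*} [Field F] [Fintype F] (V : Type*) [AddCommGroup V]
    [Module F V] [Module.Finite F V] : Nat.card (ℙ F V) =
      (Fintype.card F ^ Module.finrank F V - 1) / (Fintype.card F - 1) := by
  rw [Projectivization.card'', Module.natCard_eq_pow_finrank (K := F), Nat.card_eq_fintype_card]

/-- Take one representative of each point of projective space as a column. -/
theorem exists_isHammingCode {F : Type*} [Field F] [Fintype F] {m : ℕ} (hm : 2 ≤ m) {N : ℕ}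
    (hN : N = (Fintype.card F ^ m - 1) / (Fintype.card F - 1)) :
    ∃ D : Submodule F (Fin N → F), IsHammingCode m D := by
  have hcard : Nat.card (ℙ F (Fin m → F)) = N := by
    rw [natCard_projectivization, Module.finrank_fin_fun, hN]
  have e : Fin N ≃ ℙ F (Fin m → F) := (Finite.equivFinOfCardEq hcard).symm
  let H : Matrix (Fin m) (Fin N) F := Matrix.of fun i j => (e j).rep i
  have hcol : ∀ j, H.col j = (e j).rep := fun j => rfl
  refine ⟨LinearMap.ker H.mulVecLin, hm, H, fun x => by simp, fun j => ?_, fun v hv => ?_⟩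
  · rw [hcol]
    exact (e j).rep_nonzero
  · have key : ∀ j, (∃ a : F, v = a • H.col j) ↔ Projectivization.mk F v hv = e j := by
      intro j
      rw [hcol]
      conv_rhs => rw [← (e j).mk_rep, Projectivization.mk_eq_mk_iff']
      simp only [eq_comm]
    simp only [key]
    exact ⟨e.symm (Projectivization.mk F v hv), by simp, fun j hj => by simp [hj]⟩

/-! ### Codes of codimension one -/

section Repetition

variable {F : Type*} [Field F]

theorem IsGeneratorMatrix.exists_const {N : ℕ} {A : Matrix (Fin 1) (Fin N) F}
    (h : IsGeneratorMatrix A (repetitionCode F N)) : ∃ a : F, a ≠ 0 ∧ ∀ i j, A i j = a := by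
  have h1 : A.row 0 ∈ repetitionCode F N := h.2 ▸ Submodule.subset_span ⟨0, rfl⟩
  obtain ⟨a, ha⟩ := Submodule.mem_span_singleton.1 h1
  refine ⟨a, ?_, fun i j => ?_⟩
  · rintro rfl
    exact h.1.ne_zero 0 (by rw [← ha, zero_smul])
  · rw [Subsingleton.elim i 0]
    have := congrFun ha j
    simpa using this.symm

/-- In a one-row matrix with constant nonzero entry every column is a multiple of every nonzero
syndrome, so the multiplicity is N. -/
theorem isEquivalent_ker_const {ι : Type*} [Fintype ι] [DecidableEq ι] {C : Submodule F (ι → F)}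
    {N : ℕ} (hrank : Module.finrank F ((ι → F) ⧸ C) = 1)
    (hC : ∀ x, x ∉ C → colMult C x = N) (h0 : ∀ j, Pi.single j (1 : F) ∉ C)
    {A : Matrix (Fin 1) (Fin N) F} (hA : IsGeneratorMatrix A (repetitionCode F N)) :
    ∃ D : Submodule F (Fin N → F), IsParityCheckMatrix A D ∧ IsEquivalent C D := by
  obtain ⟨a, ha, hAa⟩ := hA.exists_const
  have hD : IsParityCheckMatrix A (LinearMap.ker A.mulVecLin) := ⟨hA.1, fun x => by simp⟩
  refine ⟨_, hD, isEquivalent_of_colMult_eq ?_ hC (fun x hx => ?_) h0 fun j => ?_⟩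
  · rw [hrank, hD.finrank_quotient, Fintype.card_fin]
  · have hall : ∀ j, ∃ u : Fˣ, x - Pi.single j (u : F) ∈ LinearMap.ker A.mulVecLin := fun j => by
      rw [exists_unit_sub_single_mem_iff hD.2 hx]
      refine ⟨A.mulVec x 0 / a, funext fun i => ?_⟩
      rw [Subsingleton.elim i 0]
      simp [hAa, ha]
    rw [colMult, Nat.card_congr (Equiv.subtypeUnivEquiv hall), Nat.card_fin]
  · rw [single_mem_iff hD.2]
    intro h
    exact ha ((hAa 0 j).symm.trans (congrFun h 0))

end Repetition

/-! ### Kronecker products with a repetition generator -/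

section Kronecker

variable {F : Type*} [Field F] {N m : ℕ} {ν : Type*} [Fintype ν] {A : Matrix (Fin 1) (Fin N) F}
  {B : Matrix (Fin m) ν F} {D : Submodule F (ν → F)} {a : F}

theorem kronecker_const_apply {F ν : Type*} [Field F] {N m : ℕ} {A : Matrix (Fin 1) (Fin N) F}
    {B : Matrix (Fin m) ν F} {a : F} (hA : ∀ i j, A i j = a) (p : Fin 1 × Fin m)
    (q : Fin N × ν) : Matrix.kronecker A B p q = a * B p.2 q.2 := by
  rw [← hA p.1 q.1]
  rfl

theorem isParityCheckMatrix_kronecker_const (hN : 0 < N) (ha : a ≠ 0) (hA : ∀ i j, A i j = a)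
    (hB : IsParityCheckMatrix B D) :
    IsParityCheckMatrix (Matrix.kronecker A B)
      (LinearMap.ker (Matrix.kronecker A B).mulVecLin) := by
  refine ⟨?_, fun x => by simp⟩
  rw [Fintype.linearIndependent_iff]
  rintro g hg ⟨i, l⟩
  rw [Subsingleton.elim i 0]
  refine Fintype.linearIndependent_iff.1 hB.1 (fun l => g (0, l)) (funext fun j => ?_) l
  -- One block of columns, a multiple of B, suffices for independence; it exists because N > 0.
  have h1 := congrFun hg (⟨0, hN⟩, j)
  simp only [Fintype.sum_prod_type, Finset.univ_unique, Finset.sum_singleton, Finset.sum_apply,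
    Pi.smul_apply, Matrix.row_apply, kronecker_const_apply hA, smul_eq_mul,
    Pi.zero_apply] at h1 ⊢
  refine (mul_eq_zero.1 (?_ : a * _ = 0)).resolve_left ha
  rw [← h1, Finset.mul_sum]
  refine Finset.sum_congr rfl fun k _ => ?_
  rw [mul_left_comm, Subsingleton.elim (default : Fin 1) 0]

/-- The matrix consists of N copies of aB side by side, so a syndrome represented by one column of B
is represented by N columns here. -/
theorem colMult_ker_kronecker_const [DecidableEq ν] (ha : a ≠ 0) (hA : ∀ i j, A i j = a)
    (hB : IsParityCheckMatrix B D) (hD : ∀ x, x ∉ D → colMult D x = 1) {y : Fin N × ν → F}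
    (hy : y ∉ LinearMap.ker (Matrix.kronecker A B).mulVecLin) :
    colMult (LinearMap.ker (Matrix.kronecker A B).mulVecLin) y = N := by
  -- Choose x with the same syndrome under B as y has under the product, so that uniqueness of the
  -- column of B applies.
  obtain ⟨x, hx⟩ := hB.mulVec_surjective fun l => (Matrix.kronecker A B).mulVec y (0, l)
  have hxD : x ∉ D := fun h => hy <| by
    rw [hB.2, hx] at h
    rw [LinearMap.mem_ker, Matrix.mulVecLin_apply]
    ext ⟨i, l⟩
    rw [Subsingleton.elim i 0]
    exact congrFun h l
  obtain ⟨j₀, hj₀, huniq⟩ := colMult_eq_one_iff.1 (hD x hxD)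
  simp only [exists_unit_sub_single_mem_iff hB.2 hxD] at hj₀ huniq
  have key : ∀ p : Fin N × ν, (∃ u : Fˣ, y - Pi.single p (u : F) ∈
      LinearMap.ker (Matrix.kronecker A B).mulVecLin) ↔ p.2 = j₀ := by
    rintro ⟨i, j⟩
    rw [exists_unit_sub_single_mem_iff (H := Matrix.kronecker A B) (fun x => by simp) hy]
    constructor
    · rintro ⟨b, hb⟩
      refine huniq j ⟨b * a, ?_⟩
      rw [hx]
      ext l
      have := congrFun hb (0, l)
      simpa [hA, mul_assoc] using this
    · rintro rfl
      obtain ⟨b, hb⟩ := hj₀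
      refine ⟨b / a, ?_⟩
      ext ⟨k, l⟩
      rw [Subsingleton.elim k 0]
      have := congrFun (hx.symm.trans hb) l
      simp only [Pi.smul_apply, Matrix.col_apply, smul_eq_mul,
        kronecker_const_apply hA] at this ⊢
      rw [this, ← mul_assoc, div_mul_cancel₀ _ ha]
  rw [colMult, Nat.card_congr ((Equiv.subtypeEquivRight key).trans
    (⟨fun p => p.1.1, fun i => ⟨(i, j₀), rfl⟩, fun p => Subtype.ext (Prod.ext rfl p.2.symm),
      fun _ => rfl⟩ : {p : Fin N × ν // p.2 = j₀} ≃ Fin N)), Nat.card_fin]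

theorem isEquivalent_ker_kronecker [DecidableEq ν] {ι : Type*} [Fintype ι] [DecidableEq ι]
    {C : Submodule F (ι → F)} (hN : 0 < N) (hrank : Module.finrank F ((ι → F) ⧸ C) = m)
    (hC : ∀ x, x ∉ C → colMult C x = N) (h0 : ∀ j, Pi.single j (1 : F) ∉ C)
    (hA : IsGeneratorMatrix A (repetitionCode F N)) (hD : IsHammingCode m D)
    (hB : IsParityCheckMatrix B D) :
    ∃ C' : Submodule F (Fin N × ν → F),
      IsParityCheckMatrix (Matrix.kronecker A B) C' ∧ IsEquivalent C C' := by
  obtain ⟨a, ha, hAa⟩ := hA.exists_const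
  have hP := isParityCheckMatrix_kronecker_const hN ha hAa hB
  refine ⟨_, hP, isEquivalent_of_colMult_eq ?_ hC (fun x hx => colMult_ker_kronecker_const ha hAa hB
    (fun _ => hD.colMult_eq_one) hx) h0 ?_⟩
  · rw [hrank, hP.finrank_quotient]
    simp
  · rintro ⟨i, j⟩
    rw [single_mem_iff hP.2]
    intro h
    refine hD.single_notMem j ((single_mem_iff hB.2).2 (funext fun l => ?_))
    have := congrFun h (0, l)
    simpa [hAa, ha] using this

end Kronecker

end LinearCode

/-! ### The classification -/

open LinearCode in
theorem mainTheorem1 {F : Type*} [Field F] [Fintype F] [DecidableEq F]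
    (n k d : ℕ) (C : Submodule F (Fin n → F))
    (hk : Module.finrank F C = k) (hd : minDist C = d)
    (hCR : IsCompletelyRegular C) (hρ : coveringRadius C = 1) :
    -- the possible minimum distances
    ((n = 1 ∧ C = ⊥) ∨ d = 1 ∨ d = 2 ∨ d = 3) ∧
    -- (i)
    (d = 1 → ∃ (m : ℕ) (C' : Submodule F (Fin m → F)) (e : Fin n ≃ Fin (m + 1)),
      C = (qRepeated C').map (LinearMap.funLeft F F e) ∧
      IsCompletelyRegular C' ∧ coveringRadius C' = 1 ∧
      ((m = 1 ∧ C' = ⊥) ∨ minDist C' = 1 ∨ minDist C' = 2 ∨ minDist C' = 3)) ∧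
    -- `nₐ` is the number of codewords at distance one from any vector outside the code
    (∃ nₐ : ℕ, (∀ x, x ∉ C → numAtDist C x 1 = nₐ) ∧
      -- (ii)
      (d = 2 → 1 < nₐ ∧
        ((n = nₐ ∧ k + 1 = n ∧
          ∀ A : Matrix (Fin 1) (Fin nₐ) F, IsGeneratorMatrix A (repetitionCode F nₐ) →
            ∃ C' : Submodule F (Fin nₐ → F), IsParityCheckMatrix A C' ∧ IsEquivalent C C') ∨
        (∃ n_b m_b : ℕ, n = nₐ * n_b ∧ k + m_b = n ∧
          n_b = (Fintype.card F ^ m_b - 1) / (Fintype.card F - 1) ∧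
          (∃ D : Submodule F (Fin n_b → F), IsHammingCode m_b D) ∧
          ∀ (A : Matrix (Fin 1) (Fin nₐ) F) (B : Matrix (Fin m_b) (Fin n_b) F)
            (D : Submodule F (Fin n_b → F)),
            IsGeneratorMatrix A (repetitionCode F nₐ) →
            IsHammingCode m_b D → IsParityCheckMatrix B D →
            ∃ C' : Submodule F (Fin nₐ × Fin n_b → F),
              IsParityCheckMatrix (Matrix.kronecker A B) C' ∧ IsEquivalent C C'))) ∧
      -- (iii)
      (d = 3 → nₐ = 1 ∧
        ∃ m_b : ℕ, IsHammingCode m_b C ∧ k + m_b = n ∧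
          n = (Fintype.card F ^ m_b - 1) / (Fintype.card F - 1) ∧
          ∃ B : Matrix (Fin m_b) (Fin n) F, IsParityCheckMatrix B C)) ∧
    -- (iv)
    IsCompletelyTransitive C := by
  obtain ⟨r, hr, hC⟩ := exists_colMult_eq hCR hρ
  have hne := ne_top_of_coveringRadius_eq_one hρ
  have hq : 1 < Fintype.card F := Fintype.one_lt_card
  have hkm : k + Module.finrank F ((Fin n → F) ⧸ C) = n := by
    have := C.finrank_quotient_add_finrank
    rw [Module.finrank_fin_fun] at this
    omega
  have hm : 0 < Module.finrank F ((Fin n → F) ⧸ C) := by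
    have := Submodule.Quotient.nontrivial_iff.2 hne
    exact Module.finrank_pos
  have hlen : 1 < d → n = r * ((Fintype.card F ^ Module.finrank F ((Fin n → F) ⧸ C) - 1) /
      (Fintype.card F - 1)) := fun h1 => by
    have := card_eq_mul_card_projectivization hC (single_notMem_of_one_lt_minDist (hd ▸ h1))
    rwa [Fintype.card_fin, natCard_projectivization] at this
  refine ⟨hd ▸ minDist_cases hρ, fun h1 => ?_, ⟨r, fun x hx => ?_, fun h2 => ?_, fun h3 => ?_⟩, ?_⟩
  · obtain ⟨j₀, hj₀⟩ := exists_single_mem_of_minDist_eq_one (hd.trans h1)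
    obtain ⟨m, C', e, hCe, hCR', hρ'⟩ := exists_qRepeated hne hr hC hj₀
    exact ⟨m, C', e, hCe, hCR', hρ', minDist_cases hρ'⟩
  · rw [numAtDist_one_eq_colMult hx, hC x hx]
  · have h0 := single_notMem_of_one_lt_minDist (C := C) (by omega)
    have hlen := hlen (by omega)
    refine ⟨one_lt_of_minDist_eq_two (hd.trans h2) hC, ?_⟩
    rcases (show Module.finrank F ((Fin n → F) ⧸ C) = 1 ∨
      2 ≤ Module.finrank F ((Fin n → F) ⧸ C) by omega) with h | h
    -- With a one-dimensional quotient there is a single projective point, so n = r.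
    · rw [h] at hkm hlen
      rw [pow_one, Nat.div_self (by omega), mul_one] at hlen
      exact Or.inl ⟨hlen, hkm, fun A hA => isEquivalent_ker_const h hC h0 hA⟩
    · exact Or.inr ⟨_, _, hlen, hkm, rfl, exists_isHammingCode h rfl, fun A B D hA hD hB =>
        isEquivalent_ker_kronecker hr rfl hC h0 hA hD hB⟩
  · have h0 := single_notMem_of_one_lt_minDist (C := C) (by omega)
    obtain ⟨B, hB⟩ := exists_isParityCheckMatrix C
    have hr1 : r = 1 := by
      obtain ⟨x, hx⟩ : ∃ x, x ∉ C := by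
        by_contra! h
        exact hne (Submodule.eq_top_iff'.2 h)
      have := colMult_le_one_of_two_lt_minDist (C := C) (by omega) x
      rw [hC x hx] at this
      omega
    have hlen := hlen (by omega)
    rw [hr1, one_mul] at hlen
    refine ⟨hr1, _, hB.isHammingCode ?_ (hr1 ▸ hC) h0, hkm, hlen, B, hB⟩
    -- Redundancy 1 with r = 1 would give n = 1 and k = 0, hence C = 0, whose `minDist` is the
    -- default value 0 and not 3.
    by_contra hm2
    have h : Module.finrank F ((Fin n → F) ⧸ C) = 1 := by omega
    rw [h] at hkm hlen
    rw [pow_one, Nat.div_self (by omega)] at hlen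
    have hbot : C = ⊥ := Submodule.finrank_eq_zero.1 (by omega)
    exact ne_bot_of_minDist_pos (by omega) hbot
  · rw [IsCompletelyTransitive, hρ]
    exact card_orbits_eq_two hne hC
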